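/- Let $\Bbbk$ be an algebraically closed field of characteristic $p>0$, and let $A=(a_{ij})\in\Bbbk^{\theta\times\theta}$ be a matrix with $a_{ii}\in\{0,2\}$ for all $i$ and, for all $i\neq j$, $a_{ij}=0$ if and only if $a_{ji}=0$. Let $\mathfrak h$ be a $\Bbbk$-vector space of dimension $2\theta-\operatorname{rank}A$ with linearly independent families $(h_i)_{1\le i\le\theta}$ in $\mathfrak h$ and $(\xi_i)_{1\le i\le\theta}$ in $\mathfrak h^*$ such that $\xi_j(h_i)=a_{ij}$. Let $\widetilde{\mathfrak g}(A)$ be the Lie algebra generated by $\mathfrak h$ and $e_i,f_i$ ($1\le i\le\theta$) with relations $[h,h']=0$, $[h,e_i]=\xi_i(h)e_i$, $[h,f_i]=-\xi_i(h)f_i$, $[e_i,f_j]=\delta_{ij}h_i$, graded over $\mathbb Z$ by $\deg e_i=1$, $\deg f_i=-1$, $\deg\mathfrak h=0$, and let $\mathfrak g=\mathfrak g(A)=\widetilde{\mathfrak g}(A)/\mathfrak r$, where $\mathfrak r$ is the largest $\mathbb Z$-homogeneous ideal intersecting $\mathfrak h$ trivially. Assume that $\dim\mathfrak g<\infty$,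 put $\mathfrak g'=[\mathfrak g,\mathfrak g]$, and fix $i\in\{1,\dots,\theta\}$. Let $(\alpha_j)$ be the canonical basis of $\mathbb Z^\theta$ and $\mathfrak g=\bigoplus_{\beta\in\mathbb Z^\theta}\mathfrak g_\beta$ the grading with $\deg e_j=\alpha_j$, $\deg f_j=-\alpha_j$, $\deg\mathfrak h=0$. Put $\nabla_+=\{\beta\in\mathbb N_0^\theta\setminus\{0\}:\mathfrak g_\beta\ne0\}$ and let $\varDelta_+$ be the set of those $\beta\in\nabla_+$ that are not of the form $n\alpha$ with $\alpha\in\nabla_+$ and $n\ge2$. An *$\alpha_i$-string generator* is a $\beta\ne\alpha_i$ for which there is $j\in\{1,\dots,p\}$ with $\beta+n\alpha_i\in\varDelta_+$ for $0\le n<j$ and $\beta-\alpha_i,\ \beta+j\alpha_i\notin\varDelta_+$; for such $\beta$ (which determines $j$) put $M_\beta=\bigoplus_{n=0}^{j-1}\mathfrak g_{\beta+n\alpha_i}$. (Each of these root spaces is a line $\Bbbk e_{\beta+n\alpha_i}$.) Then $(\operatorname{ad}e_i)^p=0$ on $\mathfrak g'$, so that $\mathfrak g'$, with $t$ acting by $\operatorname{ad}e_i$,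 is a Lie algebra $(\mathfrak g',e_i)$ in $\mathsf{Rep}(\boldsymbol\alpha_p)$, the category of finite-dimensional modules over the Hopf algebra $\Bbbk[t]/(t^p)$ with $t$ primitive. Moreover, for every $\alpha_i$-string generator $\beta$, the subspace $M_\beta$ is contained in the $\mathsf{Rep}(\boldsymbol\alpha_p)$-Lie subalgebra of $(\mathfrak g',e_i)$ generated by the $M_{\alpha_j}$ with $j\neq i$, that is, in the smallest $\operatorname{ad}e_i$-stable Lie subalgebra of $\mathfrak g'$ that contains them. -/

import Mathlib

noncomputable section

namespace Contragredient

/-- A realization of the square matrix `A`: a vector space `𝔥` of dimension `2θ - rank A` with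
linearly independent families `ξ_j ∈ 𝔥*` and `h_i ∈ 𝔥` such that `ξ_j (h_i) = a_{ij}`. -/
structure Realization {k : Type*} [Field k] {θ : ℕ} (A : Matrix (Fin θ) (Fin θ) k)
    (𝔥 : Type*) [AddCommGroup 𝔥] [Module k 𝔥] where
  finite : FiniteDimensional k 𝔥
  finrank_add_rank : Module.finrank k 𝔥 + A.rank = 2 * θ
  /-- the vectors `h_i` -/
  h : Fin θ → 𝔥
  /-- the linear forms `ξ_i` -/
  ξ : Fin θ → Module.Dual k 𝔥
  linearIndependent_h : LinearIndependent k h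
  linearIndependent_ξ : LinearIndependent k ξ
  pairing : ∀ i j, ξ j (h i) = A i j

/-- Generators: the `e_i`, the `f_i`, and the elements of `𝔥`. -/
inductive Gen (θ : ℕ) (𝔥 : Type*)
  | e : Fin θ → Gen θ 𝔥
  | f : Fin θ → Gen θ 𝔥
  | h : 𝔥 → Gen θ 𝔥

section Grading

variable {k L 𝔥 Γ : Type*} [CommRing k] [LieRing L] [LieAlgebra k L] [AddCommGroup Γ] {θ : ℕ}

/-- `IsMonomial d g γ x`: `x` is an iterated bracket of the elements `g (e i)`, `g (f i)`, `g (h v)`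
of total degree `γ`, where `e i`, `f i`, `h v` have degree `d i`, `-d i`, `0`. -/
inductive IsMonomial (d : Fin θ → Γ) (g : Gen θ 𝔥 → L) : Γ → L → Prop
  | e (i : Fin θ) : IsMonomial d g (d i) (g (Gen.e i))
  | f (i : Fin θ) : IsMonomial d g (-d i) (g (Gen.f i))
  | h (v : 𝔥) : IsMonomial d g 0 (g (Gen.h v))
  | lie {γ δ : Γ} {x y : L} : IsMonomial d g γ x → IsMonomial d g δ y →
      IsMonomial d g (γ + δ) ⁅x, y⁆

variable (k) in
/-- The homogeneous component of degree `γ`, spanned by the iterated brackets of degree `γ`. -/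
def component (d : Fin θ → Γ) (g : Gen θ 𝔥 → L) (γ : Γ) : Submodule k L :=
  Submodule.span k {x | IsMonomial d g γ x}

end Grading

section Algebra

variable {k : Type*} [Field k] {θ : ℕ} {A : Matrix (Fin θ) (Fin θ) k}
  {𝔥 : Type*} [AddCommGroup 𝔥] [Module k 𝔥]

/-- The defining relations of the Lie algebra `𝔤̃(A)`. The first two say that the generators coming
from `𝔥` depend linearly on the elements of `𝔥`. -/
inductive Rel (R : Realization A 𝔥) : FreeLieAlgebra k (Gen θ 𝔥) → Prop
  | add (x y : 𝔥) : Rel R (FreeLieAlgebra.of k (Gen.h (x + y)) -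
      (FreeLieAlgebra.of k (Gen.h x) + FreeLieAlgebra.of k (Gen.h y)))
  | smul (c : k) (x : 𝔥) : Rel R (FreeLieAlgebra.of k (Gen.h (c • x)) -
      c • FreeLieAlgebra.of k (Gen.h x))
  | hh (x y : 𝔥) : Rel R ⁅(FreeLieAlgebra.of k (Gen.h x) : FreeLieAlgebra k (Gen θ 𝔥)), FreeLieAlgebra.of k (Gen.h y)⁆
  | he (x : 𝔥) (i : Fin θ) : Rel R
      (⁅(FreeLieAlgebra.of k (Gen.h x) : FreeLieAlgebra k (Gen θ 𝔥)), FreeLieAlgebra.of k (Gen.e i)⁆ -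
        R.ξ i x • FreeLieAlgebra.of k (Gen.e i))
  | hf (x : 𝔥) (i : Fin θ) : Rel R
      (⁅(FreeLieAlgebra.of k (Gen.h x) : FreeLieAlgebra k (Gen θ 𝔥)), FreeLieAlgebra.of k (Gen.f i)⁆ +
        R.ξ i x • FreeLieAlgebra.of k (Gen.f i))
  | ef_same (i : Fin θ) : Rel R
      (⁅(FreeLieAlgebra.of k (Gen.e i) : FreeLieAlgebra k (Gen θ 𝔥)), FreeLieAlgebra.of k (Gen.f i)⁆ -
        FreeLieAlgebra.of k (Gen.h (R.h i)))
  | ef_diff (i j : Fin θ) (hij : i ≠ j) : Rel R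
      ⁅(FreeLieAlgebra.of k (Gen.e i) : FreeLieAlgebra k (Gen θ 𝔥)), FreeLieAlgebra.of k (Gen.f j)⁆

/-- The ideal of the free Lie algebra generated by the defining relations. -/
def relIdeal (R : Realization A 𝔥) : LieIdeal k (FreeLieAlgebra k (Gen θ 𝔥)) :=
  LieSubmodule.lieSpan k _ {x | Rel R x}

/-- The Lie algebra `𝔤̃(A)`. -/
abbrev GTilde (R : Realization A 𝔥) := FreeLieAlgebra k (Gen θ 𝔥) ⧸ relIdeal R

/-- The generators of `𝔤̃(A)`. -/
def genTilde (R : Realization A 𝔥) (x : Gen θ 𝔥) : GTilde R :=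
  LieSubmodule.Quotient.mk (FreeLieAlgebra.of k x)

/-- An ideal of `𝔤̃(A)` is `ℤ`-homogeneous if it is the sum of its intersections with the components
of the `ℤ`-grading for which `e_i`, `f_i`, `𝔥` have degree `1`, `-1`, `0`. -/
def IsHomogeneousIdeal (R : Realization A 𝔥) (I : LieIdeal k (GTilde R)) : Prop :=
  I.toSubmodule = ⨆ n : ℤ, I.toSubmodule ⊓ component k (fun _ : Fin θ => (1 : ℤ)) (genTilde R) n

/-- The largest `ℤ`-homogeneous ideal of `𝔤̃(A)` that intersects `𝔥` trivially, as the sum of all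
such ideals. -/
def radical (R : Realization A 𝔥) : LieIdeal k (GTilde R) :=
  sSup {I | IsHomogeneousIdeal R I ∧ ∀ x : 𝔥, genTilde R (Gen.h x) ∈ I → genTilde R (Gen.h x) = 0}

/-- The contragredient Lie algebra `𝔤(A)`. -/
abbrev G (R : Realization A 𝔥) := GTilde R ⧸ radical R

/-- The generators of `𝔤(A)`. -/
def gen (R : Realization A 𝔥) (x : Gen θ 𝔥) : G R :=
  LieSubmodule.Quotient.mk (genTilde R x)

/-- The simple root `α_i` in `ℤ^θ`. -/
def simpleRoot (i : Fin θ) : Fin θ → ℤ := Pi.single i 1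

/-- The component `𝔤_β` of the `ℤ^θ`-grading of `𝔤(A)` for which `e_i`, `f_i`, `𝔥` have degree
`α_i`, `-α_i`, `0`. -/
def rootSpace (R : Realization A 𝔥) (β : Fin θ → ℤ) : Submodule k (G R) :=
  component k simpleRoot (gen R) β

/-- The set `∇₊` of positive roots. -/
def nablaPos (R : Realization A 𝔥) : Set (Fin θ → ℤ) :=
  {β | β ≠ 0 ∧ rootSpace R β ≠ ⊥ ∧ ∀ i, 0 ≤ β i}

/-- The set `Δ₊` of positive roots that are not a multiple `n α`, `n ≥ 2`, of a positive root. -/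
def deltaPos (R : Realization A 𝔥) : Set (Fin θ → ℤ) :=
  nablaPos R \ {β | ∃ α ∈ nablaPos R, ∃ n : ℕ, 2 ≤ n ∧ β = n • α}

/-- `β` generates a maximal `α_i`-string of length `j`. -/
def GeneratesString (R : Realization A 𝔥) (i : Fin θ) (j : ℕ) (β : Fin θ → ℤ) : Prop :=
  β ≠ simpleRoot i ∧ (∀ n : ℕ, n < j → β + n • simpleRoot i ∈ deltaPos R) ∧
    β - simpleRoot i ∉ deltaPos R ∧ β + j • simpleRoot i ∉ deltaPos R

/-- `β` is an `α_i`-string generator: it generates a maximal `α_i`-string of length in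
`{1, …, p}`. -/
def IsStringGenerator (p : ℕ) (R : Realization A 𝔥) (i : Fin θ) (β : Fin θ → ℤ) : Prop :=
  ∃ j ∈ Finset.Icc 1 p, GeneratesString R i j β

/-- `M_β`, the sum of the root spaces `𝔤_{β + n α_i}`, `0 ≤ n < j`, if `β` generates a maximal
`α_i`-string of length `j ∈ {1, …, p}` (such a `j` is determined by `β` and `i`). Whenever `𝔤(A)`
is finite-dimensional its root spaces are lines `k e_γ`, and this is `⨁_{n < j} k e_{β + n α_i}`. -/
def stringModule (p : ℕ) (R : Realization A 𝔥) (i : Fin θ) (β : Fin θ → ℤ) :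
    Submodule k (G R) :=
  ⨆ j ∈ {j : ℕ | j ∈ Finset.Icc 1 p ∧ GeneratesString R i j β},
    ⨆ n ∈ Finset.range j, rootSpace R (β + n • simpleRoot i)

/-- The derived algebra `𝔤' = [𝔤, 𝔤]`. -/
def derived (R : Realization A 𝔥) : LieIdeal k (G R) :=
  ⁅(⊤ : LieIdeal k (G R)), (⊤ : LieIdeal k (G R))⁆

/-- The derivation of `𝔤'` given by `ad e_i`. -/
def adE (R : Realization A 𝔥) (i : Fin θ) : LieDerivation k (derived R) (derived R) where
  toLinearMap := LieModule.toEnd k (G R) (derived R) (gen R (Gen.e i))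
  leibniz' a b := by
    apply Subtype.ext
    have h := leibniz_lie (gen R (Gen.e i)) (a : G R) (b : G R)
    simp only [LieModule.toEnd_apply_apply, LieSubmodule.coe_bracket, LieSubmodule.coe_sub,
      LieIdeal.coe_bracket_of_module]
    rw [h, ← lie_skew (b : G R) ⁅gen R (Gen.e i), (a : G R)⁆]
    abel

end Algebra

section RepAlphaP

variable {k L : Type*} [Field k] [LieRing L] [LieAlgebra k L]

/-- `(L, D)` is a Lie algebra in `Rep(α_p)`, the category of finite-dimensional modules over the
Hopf algebra `k[t]/(t^p)` with `t` primitive: `t` acts by the derivation `D`, so that the bracket is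
a morphism of modules, and `D ^ p = 0`. -/
def IsAlphaPLieAlgebra (p : ℕ) (D : LieDerivation k L L) : Prop :=
  FiniteDimensional k L ∧ ((D : L →ₗ[k] L) : Module.End k L) ^ p = 0

/-- A Lie subalgebra of `(L, D)` in `Rep(α_p)`: a Lie subalgebra that is a submodule, that is,
stable under the action of `t`. -/
def IsAlphaPLieSubalgebra (D : LieDerivation k L L) (S : LieSubalgebra k L) : Prop :=
  ∀ x ∈ S, D x ∈ S

/-- The Lie subalgebra of `(L, D)` in `Rep(α_p)` generated by a subset `s`. -/
def alphaPLieSpan (D : LieDerivation k L L) (s : Set L) : LieSubalgebra k L :=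
  sInf {S | IsAlphaPLieSubalgebra D S ∧ s ⊆ S}

theorem isAlphaPLieSubalgebra_alphaPLieSpan (D : LieDerivation k L L) (s : Set L) :
    IsAlphaPLieSubalgebra D (alphaPLieSpan D s) ∧ s ⊆ alphaPLieSpan D s := by
  refine ⟨fun x hx => ?_, fun x hx => ?_⟩
  · rw [alphaPLieSpan, ← SetLike.mem_coe, LieSubalgebra.coe_sInf, Set.mem_iInter₂] at hx ⊢
    exact fun S hS => hS.1 x (hx S hS)
  · rw [alphaPLieSpan, LieSubalgebra.coe_sInf, Set.mem_iInter₂]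
    exact fun S hS => hS.2 hx

end RepAlphaP

end Contragredient

end

namespace Contragredient

/-! Nilpotency: in characteristic `p` the operator `(ad e_i)^p` is a derivation, so its kernel is a
subalgebra and only generators need checking. On `f_j` and `𝔥` the relations suffice. On `e_j`, the
element `(ad e_i)^p e_j` of `𝔤̃(A)` is a weight vector of degree `p + 1` killed by every `f_l`; such
a vector generates an ideal living in positive degrees, hence lies in the radical
(`mem_radical_of_f_lie_eq_zero`).

Generation: by the triangular decomposition (`ChevalleyRelations.component_le`) a positive root
space is spanned by right-normed brackets of the `e_j`. If `K` contains all `e_j` with `j ≠ i`, is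
closed under brackets and is `ad e_i`-stable, then such a bracket either lies in `K` or is `e_i`
itself, because `[e_i, e_i] = 0` (`IsRightNormed.mem_or_eq`). No term of a string is `α_i`, so `M_β
≤ K`. It remains that `e_j ∈ M_{α_j}`: the `α_i`-string through `α_j` has length at most `p` by the
nilpotency (`gen_e_mem_stringModule`). -/

theorem isMonomial_ad_pow_e {k L 𝔥 Γ : Type*} [CommRing k] [LieRing L] [LieAlgebra k L]
    [AddCommGroup Γ] {θ : ℕ} {g : Gen θ 𝔥 → L} (d : Fin θ → Γ) (i j : Fin θ) (n : ℕ) :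
    IsMonomial d g (n • d i + d j) ((LieAlgebra.ad k L (g (Gen.e i)) ^ n) (g (Gen.e j))) := by
  induction n with
  | zero => simpa using IsMonomial.e j
  | succ n ih =>
    rw [pow_succ', Module.End.mul_apply, LieAlgebra.ad_apply, succ_nsmul', add_assoc]
    exact (IsMonomial.e i).lie ih

/-! ### Chevalley relations and `p`-th powers of `ad e_i` -/

section Generic

variable {k : Type*} [Field k] {θ : ℕ} {A : Matrix (Fin θ) (Fin θ) k}
  {𝔥 : Type*} [AddCommGroup 𝔥] [Module k 𝔥]

/-- The elements `g x` of a Lie algebra satisfy the Chevalley-type relations of `𝔤̃(A)`. -/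
structure ChevalleyRelations (R : Realization A 𝔥) {L : Type*} [LieRing L] [LieAlgebra k L]
    (g : Gen θ 𝔥 → L) : Prop where
  hh : ∀ x y, ⁅g (Gen.h x), g (Gen.h y)⁆ = 0
  he : ∀ x i, ⁅g (Gen.h x), g (Gen.e i)⁆ = R.ξ i x • g (Gen.e i)
  hf : ∀ x i, ⁅g (Gen.h x), g (Gen.f i)⁆ = -(R.ξ i x • g (Gen.f i))
  ef_same : ∀ i, ⁅g (Gen.e i), g (Gen.f i)⁆ = g (Gen.h (R.h i))
  ef_diff : ∀ i j, i ≠ j → ⁅g (Gen.e i), g (Gen.f j)⁆ = 0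

theorem chevalleyRelations_genTilde (R : Realization A 𝔥) :
    ChevalleyRelations R (genTilde R) := by
  have key : ∀ x, Rel R x → (LieSubmodule.Quotient.mk x : GTilde R) = 0 := fun x hx =>
    LieSubmodule.Quotient.mk_eq_zero'.2 (LieSubmodule.subset_lieSpan hx)
  refine ⟨fun x y => key _ (Rel.hh x y), fun x i => ?_, fun x i => ?_, fun i => ?_,
    fun i j hij => key _ (Rel.ef_diff i j hij)⟩
  · exact sub_eq_zero.1 (key _ (Rel.he x i))
  · exact eq_neg_of_add_eq_zero_left (key _ (Rel.hf x i))
  · exact sub_eq_zero.1 (key _ (Rel.ef_same i))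

theorem chevalleyRelations_gen (R : Realization A 𝔥) : ChevalleyRelations R (gen R) := by
  have H := chevalleyRelations_genTilde R
  let q := LieSubmodule.Quotient.mk (N := radical R)
  refine ⟨fun x y => congrArg q (H.hh x y), fun x i => congrArg q (H.he x i),
    fun x i => congrArg q (H.hf x i), fun i => congrArg q (H.ef_same i),
    fun i j hij => congrArg q (H.ef_diff i j hij)⟩

/-- The map into `S` lifted from the generators, followed by the inclusion, is the identity by
uniqueness of lifts. -/
theorem mem_of_forall_of_mem {X : Type*} (S : LieSubalgebra k (FreeLieAlgebra k X))
    (h : ∀ x, FreeLieAlgebra.of k x ∈ S) (y : FreeLieAlgebra k X) : y ∈ S := by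
  let F : FreeLieAlgebra k X →ₗ⁅k⁆ S := FreeLieAlgebra.lift k fun x => ⟨FreeLieAlgebra.of k x, h x⟩
  have hF : S.incl.comp F = LieHom.id := FreeLieAlgebra.hom_ext fun x => by simp [F]
  have : (F y : FreeLieAlgebra k X) = y := congrArg (fun G => G y) hF
  exact this ▸ (F y).2

theorem mem_of_forall_genTilde_mem (R : Realization A 𝔥) (S : LieSubalgebra k (GTilde R))
    (h : ∀ x, genTilde R x ∈ S) (y : GTilde R) : y ∈ S := by
  let S' : LieSubalgebra k (FreeLieAlgebra k (Gen θ 𝔥)) :=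
    { (S.toSubmodule.comap (LieSubmodule.Quotient.mk' (relIdeal R) : _ →ₗ[k] GTilde R)) with
      lie_mem' := fun {a b} ha hb => S.lie_mem ha hb }
  obtain ⟨y, rfl⟩ := LieSubmodule.Quotient.surjective_mk' _ y
  exact mem_of_forall_of_mem S' h y

theorem mem_of_forall_gen_mem (R : Realization A 𝔥) (S : LieSubalgebra k (G R))
    (h : ∀ x, gen R x ∈ S) (y : G R) : y ∈ S := by
  let S' : LieSubalgebra k (GTilde R) :=
    { (S.toSubmodule.comap (LieSubmodule.Quotient.mk' (radical R) : _ →ₗ[k] G R)) with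
      lie_mem' := fun {a b} ha hb => S.lie_mem ha hb }
  obtain ⟨y, rfl⟩ := LieSubmodule.Quotient.surjective_mk' _ y
  exact mem_of_forall_genTilde_mem R S' h y

/-- In characteristic `p`, the `p`-th power of an inner derivation is a derivation. -/
theorem ad_pow_char_lie {L : Type*} [LieRing L] [LieAlgebra k L] (p : ℕ) [Fact p.Prime] [CharP k p]
    (e x y : L) : (LieAlgebra.ad k L e ^ p) ⁅x, y⁆ =
      ⁅(LieAlgebra.ad k L e ^ p) x, y⁆ + ⁅x, (LieAlgebra.ad k L e ^ p) y⁆ := by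
  have h := LieDerivation.iterate_apply_lie' (LieDerivation.ad k L e) p x y
  have hp := (Fact.out : p.Prime)
  rw [Finset.sum_range_succ, Finset.range_eq_Ico, Finset.sum_eq_sum_Ico_succ_bot hp.pos,
    Finset.sum_eq_zero (s := Finset.Ico (0 + 1) p)] at h
  · have hD : ∀ n (z : L), (LieDerivation.ad k L e)^[n] z = (LieAlgebra.ad k L e ^ n) z := by
      intro n z
      rw [Module.End.pow_apply]
      refine congrFun (congrArg (fun F : L → L => F^[n]) (funext fun w => ?_)) z
      simp
    simp only [hD] at h
    simpa [add_comm] using h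
  · intro i hi
    -- The inner terms of the Leibniz formula carry binomial coefficients divisible by `p`.
    rw [Finset.mem_Ico] at hi
    obtain ⟨c, hc⟩ := hp.dvd_choose_self (by omega) hi.2
    rw [← Nat.cast_smul_eq_nsmul k, hc, Nat.cast_mul, CharP.cast_eq_zero, zero_mul, zero_smul]

section

variable {R : Realization A 𝔥} {L : Type*} [LieRing L] [LieAlgebra k L] {g : Gen θ 𝔥 → L}

theorem ChevalleyRelations.eh (H : ChevalleyRelations R g) (x : 𝔥) (i : Fin θ) :
    ⁅g (Gen.e i), g (Gen.h x)⁆ = -(R.ξ i x • g (Gen.e i)) := by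
  rw [← lie_skew, H.he]

theorem ChevalleyRelations.ad_pow_h (H : ChevalleyRelations R g) (i : Fin θ) (x : 𝔥) {n : ℕ}
    (hn : 2 ≤ n) : (LieAlgebra.ad k L (g (Gen.e i)) ^ n) (g (Gen.h x)) = 0 := by
  obtain ⟨m, rfl⟩ := Nat.exists_eq_add_of_le' hn
  rw [pow_add, Module.End.mul_apply]
  simp [pow_two, H.eh]

/-- For `j = i`, `ad e_i` sends `f_i ↦ h_i ↦ -a_ii e_i ↦ 0`, so the cube always vanishes; for `p =
2` the square does too, since `a_ii ∈ {0, 2}` is then `0`. -/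
theorem ChevalleyRelations.ad_pow_f (H : ChevalleyRelations R g) (p : ℕ) [Fact p.Prime] [CharP k p]
    (hdiag : ∀ i, A i i = 0 ∨ A i i = 2) (i j : Fin θ) :
    (LieAlgebra.ad k L (g (Gen.e i)) ^ p) (g (Gen.f j)) = 0 := by
  have hp := (Fact.out : p.Prime).two_le
  by_cases hij : i = j
  · subst hij
    rcases hp.eq_or_lt with rfl | hp
    · have h2 : (2 : k) = 0 := by exact_mod_cast CharP.cast_eq_zero k 2
      have hA : A i i = 0 := by rcases hdiag i with h | h <;> simp [h, h2]
      simp [pow_two, H.ef_same, H.eh, R.pairing, hA]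
    · obtain ⟨m, rfl⟩ := Nat.exists_eq_add_of_le' (show 1 ≤ p by omega)
      rw [pow_succ, Module.End.mul_apply, LieAlgebra.ad_apply, H.ef_same,
        H.ad_pow_h i _ (by omega)]
  · obtain ⟨m, rfl⟩ := Nat.exists_eq_add_of_le' (show 1 ≤ p by omega)
    rw [pow_succ, Module.End.mul_apply, LieAlgebra.ad_apply, H.ef_diff i j hij, map_zero]

/-- Apply the derivation `(ad e_i)^p` to `[e_j, f_l]`, which is `0` or `h_j`: the result is zero,
and so is the term containing `(ad e_i)^p f_l`. -/
theorem ChevalleyRelations.f_lie_ad_pow_e (H : ChevalleyRelations R g) (p : ℕ) [Fact p.Prime]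
    [CharP k p] (hdiag : ∀ i, A i i = 0 ∨ A i i = 2) (i j l : Fin θ) :
    ⁅g (Gen.f l), (LieAlgebra.ad k L (g (Gen.e i)) ^ p) (g (Gen.e j))⁆ = 0 := by
  have hp := (Fact.out : p.Prime).two_le
  have h := ad_pow_char_lie p (g (Gen.e i)) (g (Gen.e j)) (g (Gen.f l)) (k := k)
  rw [H.ad_pow_f p hdiag, lie_zero, add_zero] at h
  rw [← lie_skew, ← h]
  by_cases hjl : j = l
  · subst hjl
    rw [H.ef_same, H.ad_pow_h i _ hp, neg_zero]
  · rw [H.ef_diff j l hjl, map_zero, neg_zero]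

theorem ChevalleyRelations.h_lie_ad_pow_e (H : ChevalleyRelations R g) (i j : Fin θ) (x : 𝔥)
    (n : ℕ) : ∃ c : k, ⁅g (Gen.h x), (LieAlgebra.ad k L (g (Gen.e i)) ^ n) (g (Gen.e j))⁆ =
      c • (LieAlgebra.ad k L (g (Gen.e i)) ^ n) (g (Gen.e j)) := by
  induction n with
  | zero => exact ⟨R.ξ j x, by simp [H.he]⟩
  | succ n ih =>
    obtain ⟨c, hc⟩ := ih
    refine ⟨R.ξ i x + c, ?_⟩
    rw [pow_succ', Module.End.mul_apply, LieAlgebra.ad_apply, leibniz_lie, hc, H.he, smul_lie,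
      lie_smul, add_smul]

end

end Generic

/-! ### Torus action, the radical, and nilpotency of `ad e_i` -/

section ZGrading

variable {k : Type*} [Field k] {θ : ℕ} {A : Matrix (Fin θ) (Fin θ) k}
  {𝔥 : Type*} [AddCommGroup 𝔥] [Module k 𝔥]

/-- The values at the generators of the torus automorphism of `𝔤̃(A)` with parameter `t`. -/
noncomputable def torusGen (R : Realization A 𝔥) (t : k) : Gen θ 𝔥 → GTilde R
  | Gen.e i => t • genTilde R (Gen.e i)
  | Gen.f i => t⁻¹ • genTilde R (Gen.f i)
  | Gen.h x => genTilde R (Gen.h x)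

theorem lift_torusGen_eq_zero (R : Realization A 𝔥) {t : k} (ht : t ≠ 0)
    (x : FreeLieAlgebra k (Gen θ 𝔥)) (hx : x ∈ relIdeal R) :
    FreeLieAlgebra.lift k (torusGen R t) x = 0 := by
  have H := chevalleyRelations_genTilde R
  have hle : relIdeal R ≤ (FreeLieAlgebra.lift k (torusGen R t)).ker := by
    refine LieSubmodule.lieSpan_le.2 fun y hy => ?_
    have key : ∀ x, Rel R x → (LieSubmodule.Quotient.mk x : GTilde R) = 0 := fun x hx =>
      LieSubmodule.Quotient.mk_eq_zero'.2 (LieSubmodule.subset_lieSpan hx)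
    rw [SetLike.mem_coe, LieHom.mem_ker]
    cases hy with
    | add x y =>
      simp only [map_sub, map_add, FreeLieAlgebra.lift_of_apply]
      exact key _ (Rel.add x y)
    | smul c x =>
      simp only [map_sub, map_smul, FreeLieAlgebra.lift_of_apply]
      exact key _ (Rel.smul c x)
    | hh x y => simp [torusGen, H.hh]
    | he x i => simp [torusGen, H.he, smul_comm t]
    | hf x i => simp [torusGen, H.hf, smul_comm t⁻¹]
    | ef_same i => simp [torusGen, H.ef_same, smul_smul, ht]
    | ef_diff i j hij => simp [torusGen, H.ef_diff i j hij]
  exact LieHom.mem_ker.1 (hle hx)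

/-- The torus automorphism of `𝔤̃(A)` with parameter `t`, as a linear map. -/
noncomputable def torusMap (R : Realization A 𝔥) {t : k} (ht : t ≠ 0) : GTilde R →ₗ[k] GTilde R :=
  (relIdeal R).toSubmodule.liftQ
    (FreeLieAlgebra.lift k (torusGen R t) : FreeLieAlgebra k (Gen θ 𝔥) →ₗ[k] GTilde R)
    fun x hx => LinearMap.mem_ker.2 (lift_torusGen_eq_zero R ht x hx)

theorem torusMap_genTilde (R : Realization A 𝔥) {t : k} (ht : t ≠ 0) (x : Gen θ 𝔥) :
    torusMap R ht (genTilde R x) = torusGen R t x :=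
  FreeLieAlgebra.lift_of_apply _ x

theorem torusMap_lie (R : Realization A 𝔥) {t : k} (ht : t ≠ 0) (x y : GTilde R) :
    torusMap R ht ⁅x, y⁆ = ⁅torusMap R ht x, torusMap R ht y⁆ := by
  obtain ⟨x, rfl⟩ := LieSubmodule.Quotient.surjective_mk' _ x
  obtain ⟨y, rfl⟩ := LieSubmodule.Quotient.surjective_mk' _ y
  exact LieHom.map_lie (FreeLieAlgebra.lift k (torusGen R t)) x y

theorem torusMap_of_isMonomial (R : Realization A 𝔥) {t : k} (ht : t ≠ 0) {n : ℤ} {x : GTilde R}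
    (hx : IsMonomial (fun _ : Fin θ => (1 : ℤ)) (genTilde R) n x) :
    torusMap R ht x = t ^ n • x := by
  induction hx with
  | e i => simp [torusMap_genTilde, torusGen]
  | f i => simp [torusMap_genTilde, torusGen]
  | h v => simp [torusMap_genTilde, torusGen]
  | lie _ _ hx hy => rw [torusMap_lie, hx, hy, smul_lie, lie_smul, smul_smul, zpow_add₀ ht]

theorem exists_ne_zero_pow_ne_one [Infinite k] {N : ℕ} (hN : 0 < N) :
    ∃ t : k, t ≠ 0 ∧ t ^ N ≠ 1 := by
  by_contra! h
  have : (Polynomial.X * (Polynomial.X ^ N - Polynomial.C 1) : Polynomial k) = 0 := by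
    refine Polynomial.funext fun t => ?_
    by_cases ht : t = 0
    · simp [ht]
    · simp [h t ht]
  exact mul_ne_zero Polynomial.X_ne_zero (Polynomial.X_pow_sub_C_ne_zero hN 1) this

/-- Degrees are separated by torus eigenvalues: degree `n` lies in the eigenspace of `t ^ n`, and
eigenspaces are independent. -/
theorem genTilde_h_eq_zero_of_mem_span [Infinite k] (R : Realization A 𝔥) (v : 𝔥)
    (hv : genTilde R (Gen.h v) ∈ Submodule.span k {x | ∃ n : ℤ, 0 < n ∧
      IsMonomial (fun _ : Fin θ => (1 : ℤ)) (genTilde R) n x}) :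
    genTilde R (Gen.h v) = 0 := by
  classical
  obtain ⟨T, hT, hvT⟩ := Submodule.mem_span_finite_of_mem_span hv
  have hT' := fun x (hx : x ∈ T) => hT hx
  choose! n hn hmon using hT'
  -- Only finitely many degrees occur; with `N` their product, `t ^ N ≠ 1` forces `t ^ n ≠ 1` for
  -- each of them.
  obtain ⟨t, ht, htN⟩ := exists_ne_zero_pow_ne_one (k := k) (N := ∏ x ∈ T, (n x).toNat)
    (Finset.prod_pos fun x hx => by have := hn x hx; omega)
  have hind := Module.End.eigenspaces_iSupIndep (torusMap R ht) (1 : k)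
  refine (Submodule.disjoint_def.1 hind) _ ?_ ?_
  · rw [Module.End.mem_eigenspace_iff]
    simpa using torusMap_of_isMonomial R ht (IsMonomial.h v)
  · refine Submodule.span_le.2 (fun x hx => ?_) hvT
    rw [Finset.mem_coe] at hx
    have hxn : t ^ n x ≠ 1 := by
      intro h1
      refine htN ?_
      have h2 : t ^ (n x).toNat = 1 := by
        rw [← zpow_natCast, Int.toNat_of_nonneg (hn x hx).le, h1]
      obtain ⟨c, hc⟩ := Finset.dvd_prod_of_mem (fun x => (n x).toNat) hx
      rw [hc, pow_mul, h2, one_pow]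
    refine Submodule.mem_iSup_of_mem (t ^ n x) (Submodule.mem_iSup_of_mem hxn ?_)
    rw [Module.End.mem_eigenspace_iff]
    exact torusMap_of_isMonomial R ht (hmon x hx)

/-- The elements obtained from `x`, of degree `n`, by successive brackets with the `e_i`. -/
inductive IsRaised (R : Realization A 𝔥) (n : ℤ) (x : GTilde R) : ℤ → GTilde R → Prop
  | base : IsRaised R n x n x
  | step {m : ℤ} {y : GTilde R} (i : Fin θ) : IsRaised R n x m y →
      IsRaised R n x (1 + m) ⁅genTilde R (Gen.e i), y⁆

/-- A homogeneous weight vector of positive degree annihilated by all the `f_i` lies in the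
radical. -/
theorem mem_radical_of_f_lie_eq_zero [Infinite k] (R : Realization A 𝔥) {n : ℤ} (hn : 0 < n)
    {x : GTilde R} (hx : IsMonomial (fun _ : Fin θ => (1 : ℤ)) (genTilde R) n x)
    (hf : ∀ l, ⁅genTilde R (Gen.f l), x⁆ = 0)
    (hh : ∀ v, ∃ c : k, ⁅genTilde R (Gen.h v), x⁆ = c • x) : x ∈ radical R := by
  have H := chevalleyRelations_genTilde R
  let P : Submodule k (GTilde R) := Submodule.span k {y | ∃ m, IsRaised R n x m y}
  have mono : ∀ {m y}, IsRaised R n x m y →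
      IsMonomial (fun _ : Fin θ => (1 : ℤ)) (genTilde R) m y ∧ 0 < m := by
    intro m y hy
    induction hy with
    | base => exact ⟨hx, hn⟩
    | step i _ ih => exact ⟨(IsMonomial.e i).lie ih.1, by omega⟩
  have weight : ∀ {m y}, IsRaised R n x m y → ∀ v, ∃ c : k, ⁅genTilde R (Gen.h v), y⁆ = c • y := by
    intro m y hy v
    induction hy with
    | base => exact hh v
    | step i _ ih =>
      obtain ⟨c, hc⟩ := ih
      exact ⟨R.ξ i v + c, by rw [leibniz_lie, hc, H.he, smul_lie, lie_smul, add_smul]⟩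
  have eP : ∀ i, ∀ y ∈ P, ⁅genTilde R (Gen.e i), y⁆ ∈ P := by
    intro i y hy
    refine (Submodule.span_le (p := P.comap (LieAlgebra.ad k _ (genTilde R (Gen.e i))))).2 ?_ hy
    rintro z ⟨m, hz⟩
    exact Submodule.subset_span ⟨_, hz.step i⟩
  have hP : ∀ {m y}, IsRaised R n x m y → ∀ v, ⁅genTilde R (Gen.h v), y⁆ ∈ P := by
    intro m y hy v
    obtain ⟨c, hc⟩ := weight hy v
    exact hc ▸ P.smul_mem c (Submodule.subset_span ⟨m, hy⟩)
  have fP : ∀ {m y}, IsRaised R n x m y → ∀ l, ⁅genTilde R (Gen.f l), y⁆ ∈ P := by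
    intro m y hy l
    induction hy with
    | base => rw [hf]; exact P.zero_mem
    | @step m y i hy ih =>
      rw [leibniz_lie]
      refine P.add_mem ?_ (eP i _ ih)
      rw [← lie_skew (genTilde R (Gen.f l))]
      by_cases hil : i = l
      · subst hil
        rw [H.ef_same, neg_lie]
        exact P.neg_mem (hP hy _)
      · rw [H.ef_diff i l hil, neg_zero, zero_lie]
        exact P.zero_mem
  -- The stabilizer of `P` is a subalgebra by the Jacobi identity, so stability under the generators
  -- makes `P` an ideal.
  let S : LieSubalgebra k (GTilde R) :=
    { carrier := {z | ∀ y ∈ P, ⁅z, y⁆ ∈ P}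
      add_mem' := fun ha hb y hy => by rw [add_lie]; exact P.add_mem (ha y hy) (hb y hy)
      zero_mem' := fun y _ => by rw [zero_lie]; exact P.zero_mem
      smul_mem' := fun c z hz y hy => by rw [smul_lie]; exact P.smul_mem c (hz y hy)
      lie_mem' := fun {a b} ha hb y hy => by
        rw [lie_lie]; exact P.sub_mem (ha _ (hb y hy)) (hb _ (ha y hy)) }
  have hS : ∀ z, z ∈ S := by
    refine mem_of_forall_genTilde_mem R S fun z => ?_
    have ext : (∀ m y, IsRaised R n x m y → ⁅genTilde R z, y⁆ ∈ P) → genTilde R z ∈ S := by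
      intro h y hy
      refine (Submodule.span_le (p := P.comap (LieAlgebra.ad k _ (genTilde R z)))).2 ?_ hy
      rintro w ⟨m, hw⟩
      exact h m w hw
    cases z with
    | e i => exact eP i
    | f i => exact ext fun m y hy => fP hy i
    | h v => exact ext fun m y hy => hP hy v
  let I : LieIdeal k (GTilde R) := { P with lie_mem := fun {z y} hy => hS z y hy }
  have hI : I ≤ radical R := by
    refine le_sSup ⟨le_antisymm ?_ (iSup_le fun m => inf_le_left), fun v hv => ?_⟩
    · refine Submodule.span_le.2 ?_
      rintro y ⟨m, hy⟩
      exact Submodule.mem_iSup_of_mem m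
        ⟨Submodule.subset_span ⟨m, hy⟩, Submodule.subset_span (mono hy).1⟩
    · refine genTilde_h_eq_zero_of_mem_span R v (Submodule.span_mono ?_ hv)
      rintro y ⟨m, hy⟩
      exact ⟨m, (mono hy).2, (mono hy).1⟩
  exact hI (Submodule.subset_span ⟨n, IsRaised.base⟩ : x ∈ P)

theorem ad_pow_e_gen_e [Infinite k] (p : ℕ) [Fact p.Prime] [CharP k p]
    (hdiag : ∀ i, A i i = 0 ∨ A i i = 2) (R : Realization A 𝔥) (i j : Fin θ) :
    (LieAlgebra.ad k (G R) (gen R (Gen.e i)) ^ p) (gen R (Gen.e j)) = 0 := by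
  have H := chevalleyRelations_genTilde R
  have hx := mem_radical_of_f_lie_eq_zero R (n := p • 1 + 1) (by simp)
    (isMonomial_ad_pow_e (fun _ => (1 : ℤ)) i j p)
    (H.f_lie_ad_pow_e p hdiag i j) (fun v => H.h_lie_ad_pow_e i j v p)
  rw [← LieSubmodule.Quotient.mk_eq_zero'] at hx
  have h : ∀ n, (LieAlgebra.ad k (G R) (gen R (Gen.e i)) ^ n) (gen R (Gen.e j)) =
      LieSubmodule.Quotient.mk ((LieAlgebra.ad k (GTilde R) (genTilde R (Gen.e i)) ^ n)
        (genTilde R (Gen.e j))) := by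
    intro n
    induction n with
    | zero => rfl
    | succ n ih =>
      rw [pow_succ', pow_succ', Module.End.mul_apply, Module.End.mul_apply, ih]
      rfl
  rw [h, hx]

/-- The kernel of a derivation is a subalgebra, and this one contains all generators. -/
theorem ad_pow_e_eq_zero [Infinite k] (p : ℕ) [Fact p.Prime] [CharP k p]
    (hdiag : ∀ i, A i i = 0 ∨ A i i = 2) (R : Realization A 𝔥) (i : Fin θ) :
    LieAlgebra.ad k (G R) (gen R (Gen.e i)) ^ p = 0 := by
  have H := chevalleyRelations_gen R
  let S : LieSubalgebra k (G R) :=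
    { LinearMap.ker (LieAlgebra.ad k (G R) (gen R (Gen.e i)) ^ p) with
      lie_mem' := fun {a b} ha hb => by
        change (LieAlgebra.ad k (G R) (gen R (Gen.e i)) ^ p) a = 0 at ha
        change (LieAlgebra.ad k (G R) (gen R (Gen.e i)) ^ p) b = 0 at hb
        change (LieAlgebra.ad k (G R) (gen R (Gen.e i)) ^ p) ⁅a, b⁆ = 0
        rw [ad_pow_char_lie, ha, hb, zero_lie, lie_zero, add_zero] }
  refine LinearMap.ext fun y => mem_of_forall_gen_mem R S (fun x => ?_) y
  cases x with
  | e j => exact ad_pow_e_gen_e p hdiag R i j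
  | f j => exact H.ad_pow_f p hdiag i j
  | h v => exact H.ad_pow_h i v (Fact.out : p.Prime).two_le

theorem isAlphaPLieAlgebra_adE [Infinite k] (p : ℕ) [Fact p.Prime] [CharP k p]
    (hdiag : ∀ i, A i i = 0 ∨ A i i = 2) (R : Realization A 𝔥)
    (hfin : FiniteDimensional k (G R)) (i : Fin θ) : IsAlphaPLieAlgebra p (adE R i) := by
  refine ⟨inferInstanceAs (FiniteDimensional k (derived R).toSubmodule), ?_⟩
  have h : ∀ n (x : derived R), ((((adE R i : derived R →ₗ[k] derived R) : Module.End k _) ^ n) x :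
      G R) = (LieAlgebra.ad k (G R) (gen R (Gen.e i)) ^ n) (x : G R) := by
    intro n x
    induction n with
    | zero => rfl
    | succ n ih =>
      rw [pow_succ', pow_succ', Module.End.mul_apply, Module.End.mul_apply, ← ih]
      rfl
  refine LinearMap.ext fun x => Subtype.ext ?_
  rw [h, ad_pow_e_eq_zero p hdiag R i]
  rfl

end ZGrading

/-! ### Right-normed brackets and the triangular decomposition -/

/-- `IsRightNormed d a γ x`: `x` is a right-normed iterated bracket of the elements `a i` of total
degree `γ`, where `a i` has degree `d i`. -/
inductive IsRightNormed {L Γ : Type*} [LieRing L] [AddCommGroup Γ] {θ : ℕ} (d : Fin θ → Γ)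
    (a : Fin θ → L) : Γ → L → Prop
  | base (i : Fin θ) : IsRightNormed d a (d i) (a i)
  | step {γ : Γ} {x : L} (i : Fin θ) : IsRightNormed d a γ x →
      IsRightNormed d a (d i + γ) ⁅a i, x⁆

section

variable {k L 𝔥 Γ : Type*} [Field k] [LieRing L] [LieAlgebra k L] [AddCommGroup Γ] {θ : ℕ}

variable (k) in
/-- The span of the right-normed brackets of the `a i` of degree `γ` and, if `γ = 0`, of the
elements `h v`. -/
noncomputable def borelComponent (d : Fin θ → Γ) (a : Fin θ → L) (h : 𝔥 → L) (γ : Γ) : Submodule k L :=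
  Submodule.span k {x | IsRightNormed d a γ x ∨ γ = 0 ∧ ∃ v, x = h v}

theorem lie_mem_of_mem_span {s : Set L} {P : Submodule k L} {x y : L}
    (h : ∀ z ∈ s, ⁅x, z⁆ ∈ P) (hy : y ∈ Submodule.span k s) : ⁅x, y⁆ ∈ P :=
  (Submodule.span_le (p := P.comap (LieAlgebra.ad k L x))).2 h hy

variable {d : Fin θ → Γ} {a b : Fin θ → L} {h : 𝔥 → L}

theorem IsRightNormed.exists_lie_eq_smul (ha : ∀ v i, ∃ c : k, ⁅h v, a i⁆ = c • a i) {γ : Γ} {x : L}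
    (hx : IsRightNormed d a γ x) (v : 𝔥) : ∃ c : k, ⁅h v, x⁆ = c • x := by
  induction hx with
  | base i => exact ha v i
  | step i _ ih =>
    obtain ⟨c, hc⟩ := ih
    obtain ⟨c', hc'⟩ := ha v i
    exact ⟨c' + c, by rw [leibniz_lie, hc, hc', smul_lie, lie_smul, add_smul]⟩

theorem lie_mem_borelComponent (ha : ∀ v i, ∃ c : k, ⁅h v, a i⁆ = c • a i) (i : Fin θ) {γ : Γ}
    {x : L} (hx : x ∈ borelComponent k d a h γ) : ⁅a i, x⁆ ∈ borelComponent k d a h (d i + γ) := by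
  refine lie_mem_of_mem_span ?_ hx
  rintro x (hx | ⟨rfl, v, rfl⟩)
  · exact Submodule.subset_span (Or.inl (hx.step i))
  · obtain ⟨c, hc⟩ := ha v i
    rw [← lie_skew, hc, add_zero]
    exact Submodule.neg_mem _ (Submodule.smul_mem _ _ (Submodule.subset_span (Or.inl (.base i))))

theorem IsRightNormed.lie_mem_borelComponent {d' : Fin θ → Γ} (hd : ∀ i, d' i + d i = 0)
    (ha : ∀ v i, ∃ c : k, ⁅h v, a i⁆ = c • a i) (hab : ∀ i, ∃ c : k, ∃ v, ⁅b i, a i⁆ = c • h v)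
    (hab' : ∀ i j, i ≠ j → ⁅b i, a j⁆ = 0) (i : Fin θ) {γ : Γ} {x : L}
    (hx : IsRightNormed d a γ x) : ⁅b i, x⁆ ∈ borelComponent k d a h (d' i + γ) := by
  induction hx with
  | base j =>
    by_cases hij : i = j
    · subst hij
      obtain ⟨c, v, hv⟩ := hab i
      rw [hv]
      exact Submodule.smul_mem _ _ (Submodule.subset_span (Or.inr ⟨hd i, v, rfl⟩))
    · rw [hab' i j hij]
      exact Submodule.zero_mem _
  | @step γ x j hx ih =>
    rw [leibniz_lie]
    refine Submodule.add_mem _ ?_ ?_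
    · by_cases hij : i = j
      · subst hij
        obtain ⟨c, v, hv⟩ := hab i
        obtain ⟨c', hc⟩ := hx.exists_lie_eq_smul ha v
        rw [hv, smul_lie, hc, ← add_assoc, hd, zero_add]
        exact Submodule.smul_mem _ _
          (Submodule.smul_mem _ _ (Submodule.subset_span (Or.inl hx)))
      · rw [hab' i j hij, zero_lie]
        exact Submodule.zero_mem _
    · rw [add_left_comm]
      exact Contragredient.lie_mem_borelComponent ha j ih

/-- Stated for abstract families `a`, `b` so that it serves for both `(e, f)` and `(f, e)`. -/
theorem lie_mem_sup_borelComponent {d' : Fin θ → Γ} (hd : ∀ i, d' i + d i = 0)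
    (ha : ∀ v i, ∃ c : k, ⁅h v, a i⁆ = c • a i) (hb : ∀ v i, ∃ c : k, ⁅h v, b i⁆ = c • b i)
    (hab : ∀ i, ∃ c : k, ∃ v, ⁅b i, a i⁆ = c • h v)
    (hab' : ∀ i j, i ≠ j → ⁅b i, a j⁆ = 0) (i : Fin θ) {γ : Γ} {x : L}
    (hx : x ∈ borelComponent k d a h γ ⊔ borelComponent k d' b h γ) :
    ⁅b i, x⁆ ∈ borelComponent k d a h (d' i + γ) ⊔ borelComponent k d' b h (d' i + γ) := by
  obtain ⟨y, hy, z, hz, rfl⟩ := Submodule.mem_sup.1 hx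
  rw [lie_add]
  refine Submodule.add_mem _ (lie_mem_of_mem_span ?_ hy)
    (Submodule.mem_sup_right (lie_mem_borelComponent hb i hz))
  rintro y (hy | ⟨rfl, v, rfl⟩)
  · exact Submodule.mem_sup_left (hy.lie_mem_borelComponent hd ha hab hab' i)
  · exact Submodule.mem_sup_right
      (lie_mem_borelComponent hb i (Submodule.subset_span (Or.inr ⟨rfl, v, rfl⟩)))

variable {A : Matrix (Fin θ) (Fin θ) k} [AddCommGroup 𝔥] [Module k 𝔥] {R : Realization A 𝔥}
  {g : Gen θ 𝔥 → L}

/-- The triangular decomposition of the homogeneous components. -/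
theorem ChevalleyRelations.component_le (H : ChevalleyRelations R g) (d : Fin θ → Γ) (γ : Γ) :
    component k d g γ ≤
      borelComponent k d (fun i => g (Gen.e i)) (fun v => g (Gen.h v)) γ ⊔
        borelComponent k (-d) (fun i => g (Gen.f i)) (fun v => g (Gen.h v)) γ := by
  have he : ∀ v i, ∃ c : k, ⁅g (Gen.h v), g (Gen.e i)⁆ = c • g (Gen.e i) :=
    fun v i => ⟨_, H.he v i⟩
  have hf : ∀ v i, ∃ c : k, ⁅g (Gen.h v), g (Gen.f i)⁆ = c • g (Gen.f i) :=
    fun v i => ⟨-R.ξ i v, by rw [H.hf, neg_smul]⟩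
  have hef : ∀ i, ∃ c : k, ∃ v, ⁅g (Gen.e i), g (Gen.f i)⁆ = c • g (Gen.h v) :=
    fun i => ⟨1, _, by rw [H.ef_same, one_smul]⟩
  have hfe : ∀ i, ∃ c : k, ∃ v, ⁅g (Gen.f i), g (Gen.e i)⁆ = c • g (Gen.h v) :=
    fun i => ⟨-1, _, by rw [← lie_skew, H.ef_same, neg_one_smul]⟩
  have hfe' : ∀ i j, i ≠ j → ⁅g (Gen.f i), g (Gen.e j)⁆ = 0 := fun i j hij => by
    rw [← lie_skew, H.ef_diff j i hij.symm, neg_zero]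
  set E := borelComponent k d (fun i => g (Gen.e i)) (fun v => g (Gen.h v)) with hE
  set F := borelComponent k (-d) (fun i => g (Gen.f i)) (fun v => g (Gen.h v)) with hF
  have hhE : ∀ v {d' : Fin θ → Γ} {a : Fin θ → L},
      (∀ v i, ∃ c : k, ⁅g (Gen.h v), a i⁆ = c • a i) →
      ∀ γ, ∀ y ∈ borelComponent k d' a (fun v => g (Gen.h v)) γ,
        ⁅g (Gen.h v), y⁆ ∈ borelComponent k d' a (fun v => g (Gen.h v)) γ := by
    intro v d' a ha γ y hy
    refine lie_mem_of_mem_span ?_ hy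
    rintro z (hz | ⟨-, w, rfl⟩)
    · obtain ⟨c, hc⟩ := hz.exists_lie_eq_smul ha v
      exact hc ▸ Submodule.smul_mem _ c (Submodule.subset_span (Or.inl hz))
    · rw [H.hh]
      exact Submodule.zero_mem _
  -- Monomials are arbitrary bracketings, so stability under bracketing by a whole monomial is
  -- proved, by the Jacobi identity.
  have step : ∀ γ x, IsMonomial d g γ x → ∀ δ, ∀ y ∈ E δ ⊔ F δ, ⁅x, y⁆ ∈ E (γ + δ) ⊔ F (γ + δ) := by
    intro γ x hx
    induction hx with
    | e i =>
      intro δ y hy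
      rw [sup_comm] at hy ⊢
      exact lie_mem_sup_borelComponent (fun i => by simp) hf he hef H.ef_diff i hy
    | f i =>
      intro δ y hy
      exact lie_mem_sup_borelComponent (d' := -d) (fun i => by simp) he hf hfe hfe' i hy
    | h v =>
      intro δ y hy
      obtain ⟨u, hu, z, hz, rfl⟩ := Submodule.mem_sup.1 hy
      rw [lie_add, zero_add]
      exact Submodule.add_mem_sup (hhE v he _ _ hu) (hhE v hf _ _ hz)
    | @lie γ γ' x x' _ _ ihx ihy =>
      intro δ y hy
      rw [lie_lie]
      refine Submodule.sub_mem _ ?_ ?_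
      · rw [add_assoc]
        exact ihx _ _ (ihy _ _ hy)
      · rw [add_comm γ, add_assoc]
        exact ihy _ _ (ihx _ _ hy)
  refine Submodule.span_le.2 fun x hx => ?_
  rw [SetLike.mem_coe]
  change IsMonomial d g γ x at hx
  induction hx with
  | e i => exact Submodule.mem_sup_left (Submodule.subset_span (Or.inl (.base i)))
  | f i => exact Submodule.mem_sup_right (Submodule.subset_span (Or.inl (.base (d := -d) i)))
  | h v => exact Submodule.mem_sup_left (Submodule.subset_span (Or.inr ⟨rfl, v, rfl⟩))
  | lie hx _ _ hy => exact step _ _ hx _ _ hy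

end

/-! ### Right-normed brackets of positive degree -/

section Positive

variable {L : Type*} [LieRing L] {θ : ℕ} {a : Fin θ → L}

theorem IsRightNormed.nonneg_and_ne_zero {γ : Fin θ → ℤ} {x : L}
    (hx : IsRightNormed simpleRoot a γ x) : 0 ≤ γ ∧ ∃ i, 0 < γ i := by
  have hs : ∀ i : Fin θ, 0 ≤ simpleRoot i := fun i => Pi.single_nonneg.2 zero_le_one
  induction hx with
  | base i => exact ⟨hs i, i, by simp [simpleRoot]⟩
  | step i _ ih =>
    obtain ⟨h0, j, hj⟩ := ih
    exact ⟨add_nonneg (hs i) h0, j, add_pos_of_nonneg_of_pos (hs i j) hj⟩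

theorem IsRightNormed.neg {d : Fin θ → Fin θ → ℤ} {γ : Fin θ → ℤ} {x : L}
    (hx : IsRightNormed (-d) a γ x) : IsRightNormed d a (-γ) x := by
  induction hx with
  | base i => simpa using IsRightNormed.base (d := d) (a := a) i
  | step i _ ih => simpa [add_comm] using ih.step i

variable {k : Type*} [Field k] [LieAlgebra k L]

theorem IsRightNormed.of_degree_smul_simpleRoot {i : Fin θ} {γ : Fin θ → ℤ} {x : L}
    (hx : IsRightNormed simpleRoot a γ x) (hγ : ∀ l, l ≠ i → γ l = 0) :
    x = 0 ∨ γ = simpleRoot i ∧ x = a i := by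
  induction hx with
  | base j =>
    by_cases hij : j = i
    · exact Or.inr (by simp [hij])
    · simpa [simpleRoot] using hγ j hij
  | @step γ x j hx ih =>
    have h0 := hx.nonneg_and_ne_zero.1
    have hj : j = i := by
      by_contra hij
      have h1 := hγ j hij
      have := h0 j
      simp [simpleRoot] at h1 this
      omega
    subst hj
    refine Or.inl ?_
    rcases ih fun l hl => by simpa [simpleRoot, hl] using hγ l hl with rfl | ⟨-, rfl⟩
    · exact lie_zero _
    · exact lie_self _

/-- The factor `a j` occurs once and all others are `a i`; as `[a i, a i] = 0`, it must be one of
the two innermost factors. -/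
theorem IsRightNormed.of_degree_add_smul_simpleRoot {i j : Fin θ} (hij : j ≠ i) {γ : Fin θ → ℤ}
    {x : L} (hx : IsRightNormed simpleRoot a γ x) (n : ℕ)
    (hγ : γ = simpleRoot j + n • simpleRoot i) :
    ∃ c : k, x = c • (LieAlgebra.ad k L (a i) ^ n) (a j) := by
  induction hx generalizing n with
  | base l =>
    have h1 := congrFun hγ l
    have h2 := congrFun hγ i
    by_cases hl : l = j
    · subst hl
      have hn : n = 0 := by simpa [simpleRoot, hij, hij.symm, eq_comm] using h2
      exact ⟨1, by simp [hn]⟩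
    · have h3 := congrFun hγ j
      simp [simpleRoot, hij, Ne.symm hl] at h3
  | @step γ x l hx ih =>
    have h0 := hx.nonneg_and_ne_zero.1
    by_cases hli : l = i
    · subst hli
      have h2 := congrFun hγ l
      have h3 := h0 l
      simp [simpleRoot, hij.symm] at h2 h3
      obtain ⟨m, rfl⟩ : ∃ m, n = m + 1 := ⟨n - 1, by omega⟩
      obtain ⟨c, rfl⟩ := ih m (by
        rw [succ_nsmul', add_left_comm] at hγ
        exact add_left_cancel hγ)
      exact ⟨c, by rw [pow_succ', Module.End.mul_apply, LieAlgebra.ad_apply, lie_smul]⟩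
    · by_cases hlj : l = j
      · subst hlj
        have hγ' := add_left_cancel hγ
        rcases hx.of_degree_smul_simpleRoot (i := i) fun m hm => by
          simp [hγ', simpleRoot, hm] with rfl | ⟨h1, rfl⟩
        · exact ⟨0, by simp⟩
        -- Here `x` is `[a j, a i] = -[a i, a j]`, whence the scalar `-1`.
        · have hn : n = 1 := by
            have := congrFun (hγ'.symm.trans h1) i
            simpa [simpleRoot] using this
          exact ⟨-1, by simp [hn]⟩
      · have h1 := congrFun hγ l
        have := h0 l
        simp [simpleRoot, hli, hlj] at h1 this
        omega

theorem IsRightNormed.mem_or_eq {i : Fin θ} {K : Submodule k L}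
    (ha : ∀ j, j ≠ i → a j ∈ K) (hi : ∀ x ∈ K, ⁅a i, x⁆ ∈ K) (hK : ∀ x ∈ K, ∀ y ∈ K, ⁅x, y⁆ ∈ K)
    {γ : Fin θ → ℤ} {x : L}
    (hx : IsRightNormed simpleRoot a γ x) : x ∈ K ∨ γ = simpleRoot i ∧ x = a i := by
  induction hx with
  | base j =>
    by_cases hji : j = i
    · exact Or.inr (by simp [hji])
    · exact Or.inl (ha j hji)
  | @step γ x j hx ih =>
    left
    by_cases hji : j = i
    · subst hji
      rcases ih with h | ⟨-, rfl⟩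
      · exact hi _ h
      · rw [lie_self]
        exact K.zero_mem
    · rcases ih with h | ⟨-, rfl⟩
      · exact hK _ (ha j hji) _ h
      · rw [← lie_skew]
        exact K.neg_mem (hi _ (ha j hji))

end Positive

/-! ### Root spaces and string modules -/

section StringModules

variable {k : Type*} [Field k] {θ : ℕ} {A : Matrix (Fin θ) (Fin θ) k}
  {𝔥 : Type*} [AddCommGroup 𝔥] [Module k 𝔥]

theorem rootSpace_le_span_isRightNormed (R : Realization A 𝔥) {β : Fin θ → ℤ} (hβ : β ≠ 0)
    (hβ0 : 0 ≤ β) : rootSpace R β ≤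
      Submodule.span k {x | IsRightNormed simpleRoot (fun i => gen R (Gen.e i)) β x} := by
  refine ((chevalleyRelations_gen R).component_le simpleRoot β).trans (sup_le ?_ ?_)
  · refine Submodule.span_mono ?_
    rintro x (hx | ⟨h, -⟩)
    · exact hx
    · exact absurd h hβ
  · refine Submodule.span_le.2 ?_
    rintro x (hx | ⟨h, -⟩)
    -- A bracket of the `f_i` has a negative coordinate in its degree.
    · obtain ⟨-, j, hj⟩ := hx.neg.nonneg_and_ne_zero
      have := hβ0 j
      simp at hj this
      omega
    · exact absurd h hβ

theorem simpleRoot_add_nsmul_nonneg (i j : Fin θ) (n : ℕ) :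
    0 ≤ simpleRoot j + n • simpleRoot i := by
  have hs : ∀ i : Fin θ, 0 ≤ simpleRoot i := fun i => Pi.single_nonneg.2 zero_le_one
  exact add_nonneg (hs j) (nsmul_nonneg (hs i) n)

theorem simpleRoot_add_nsmul_apply {i j : Fin θ} (hij : j ≠ i) (n : ℕ) :
    (simpleRoot j + n • simpleRoot i : Fin θ → ℤ) j = 1 := by
  simp [simpleRoot, hij]

/-- The `j`-th coordinate is `1`, so the degree is not a proper multiple. -/
theorem simpleRoot_add_nsmul_mem_deltaPos_iff (R : Realization A 𝔥) {i j : Fin θ} (hij : j ≠ i)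
    (n : ℕ) : simpleRoot j + n • simpleRoot i ∈ deltaPos R ↔
      rootSpace R (simpleRoot j + n • simpleRoot i) ≠ ⊥ := by
  have h1 := simpleRoot_add_nsmul_apply hij n
  refine ⟨fun h => h.1.2.1, fun h => ⟨⟨fun h0 => ?_, h, simpleRoot_add_nsmul_nonneg i j n⟩, ?_⟩⟩
  · rw [h0] at h1
    exact zero_ne_one h1
  · rintro ⟨α, -, m, hm, h⟩
    rw [h] at h1
    have h2 : (m : ℤ) * α j = 1 := by simpa using h1
    have h3 : (m : ℤ) ∣ 1 := ⟨α j, h2.symm⟩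
    have h4 := Int.le_of_dvd one_pos h3
    omega

theorem rootSpace_simpleRoot_add_eq_bot [Infinite k] (p : ℕ) [Fact p.Prime] [CharP k p]
    (hdiag : ∀ i, A i i = 0 ∨ A i i = 2) (R : Realization A 𝔥) {i j : Fin θ} (hij : j ≠ i) :
    rootSpace R (simpleRoot j + p • simpleRoot i) = ⊥ := by
  have h1 := simpleRoot_add_nsmul_apply hij p
  refine le_bot_iff.1 ((rootSpace_le_span_isRightNormed R (fun h0 => ?_)
    (simpleRoot_add_nsmul_nonneg i j p)).trans (Submodule.span_le.2 fun x hx => ?_))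
  · rw [h0] at h1
    exact zero_ne_one h1
  · obtain ⟨c, hc⟩ := IsRightNormed.of_degree_add_smul_simpleRoot (k := k) hij hx p rfl
    rw [hc, ad_pow_e_eq_zero p hdiag R i]
    simp

theorem gen_e_mem_stringModule [Infinite k] (p : ℕ) [Fact p.Prime] [CharP k p]
    (hdiag : ∀ i, A i i = 0 ∨ A i i = 2) (R : Realization A 𝔥) {i j : Fin θ} (hij : j ≠ i) :
    gen R (Gen.e j) ∈ stringModule p R i (simpleRoot j) := by
  classical
  have he : gen R (Gen.e j) ∈ rootSpace R (simpleRoot j + 0 • simpleRoot i) := by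
    rw [zero_nsmul, add_zero]
    exact Submodule.subset_span (IsMonomial.e j)
  by_cases h0 : rootSpace R (simpleRoot j + 0 • simpleRoot i) = ⊥
  · rw [h0, Submodule.mem_bot] at he
    rw [he]
    exact Submodule.zero_mem _
  have hex : ∃ n : ℕ, rootSpace R (simpleRoot j + n • simpleRoot i) = ⊥ :=
    ⟨p, rootSpace_simpleRoot_add_eq_bot p hdiag R hij⟩
  -- The string length is the first `n` at which the root space vanishes.
  have hpos : 0 < Nat.find hex := Nat.pos_of_ne_zero fun h => h0 (h ▸ Nat.find_spec hex)
  have hgen : GeneratesString R i (Nat.find hex) (simpleRoot j) := by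
    refine ⟨fun h => ?_, fun n hn => ?_, fun h => ?_, fun h => ?_⟩
    · have := congrFun h j
      simp [simpleRoot, hij] at this
    · exact (simpleRoot_add_nsmul_mem_deltaPos_iff R hij n).2 (Nat.find_min hex hn)
    · have := h.1.2.2 i
      simp [simpleRoot, hij.symm] at this
    · exact (simpleRoot_add_nsmul_mem_deltaPos_iff R hij _).1 h (Nat.find_spec hex)
  refine Submodule.mem_iSup_of_mem (Nat.find hex) (Submodule.mem_iSup_of_mem ⟨Finset.mem_Icc.2
    ⟨hpos, Nat.find_min' hex (rootSpace_simpleRoot_add_eq_bot p hdiag R hij)⟩, hgen⟩ ?_)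
  exact Submodule.mem_iSup_of_mem 0 (Submodule.mem_iSup_of_mem (Finset.mem_range.2 hpos) he)

/-- Since `ξ_j ≠ 0`, `e_j` is a multiple of some `[v, e_j]` with `v ∈ 𝔥`. -/
theorem gen_e_mem_derived (R : Realization A 𝔥) (j : Fin θ) : gen R (Gen.e j) ∈ derived R := by
  obtain ⟨v, hv⟩ : ∃ v, R.ξ j v ≠ 0 := by
    by_contra! h
    exact R.linearIndependent_ξ.ne_zero j (LinearMap.ext h)
  have h : ⁅gen R (Gen.h v), gen R (Gen.e j)⁆ ∈ derived R :=
    LieSubmodule.lie_mem_lie (LieSubmodule.mem_top _) (LieSubmodule.mem_top _)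
  rw [(chevalleyRelations_gen R).he] at h
  exact ((derived R).toSubmodule.smul_mem_iff hv).1 h

theorem rootSpace_le_of_ne_simpleRoot (R : Realization A 𝔥) {i : Fin θ} {K : Submodule k (G R)}
    (ha : ∀ j, j ≠ i → gen R (Gen.e j) ∈ K) (hi : ∀ x ∈ K, ⁅gen R (Gen.e i), x⁆ ∈ K)
    (hK : ∀ x ∈ K, ∀ y ∈ K, ⁅x, y⁆ ∈ K) {β : Fin θ → ℤ} (hβ : β ≠ 0) (hβ0 : 0 ≤ β)
    (hβi : β ≠ simpleRoot i) : rootSpace R β ≤ K := by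
  refine (rootSpace_le_span_isRightNormed R hβ hβ0).trans (Submodule.span_le.2 fun x hx => ?_)
  exact (IsRightNormed.mem_or_eq ha hi hK hx).resolve_right fun h => hβi h.1

theorem stringModule_le (p : ℕ) (R : Realization A 𝔥) {i : Fin θ} {K : Submodule k (G R)}
    (ha : ∀ j, j ≠ i → gen R (Gen.e j) ∈ K) (hi : ∀ x ∈ K, ⁅gen R (Gen.e i), x⁆ ∈ K)
    (hK : ∀ x ∈ K, ∀ y ∈ K, ⁅x, y⁆ ∈ K) (β : Fin θ → ℤ) : stringModule p R i β ≤ K := by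
  refine iSup₂_le fun j hj => iSup₂_le fun n hn => ?_
  obtain ⟨hj, hβi, hmem, -⟩ := hj
  have h := (hmem n (Finset.mem_range.1 hn)).1
  refine rootSpace_le_of_ne_simpleRoot R ha hi hK h.1 h.2.2 fun hn => ?_
  have h0 := (hmem 0 (Finset.mem_Icc.1 hj).1).1
  rw [zero_nsmul, add_zero] at h0
  -- If `β + n α_i = α_i`, then `β` is `α_i`, `0`, or has a negative `i`-th coordinate; all three
  -- are excluded.
  obtain rfl | rfl | ⟨m, rfl⟩ : n = 0 ∨ n = 1 ∨ ∃ m, n = m + 2 := by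
    rcases n with _ | _ | m <;> simp
  · rw [zero_nsmul, add_zero] at hn
    exact hβi hn
  · rw [one_nsmul, add_eq_right] at hn
    exact h0.1 hn
  · have h1 := congrFun hn i
    have h2 := h0.2.2 i
    simp [simpleRoot] at h1
    omega

end StringModules

end Contragredient

theorem mainTheorem5 {k : Type*} [Field k] [IsAlgClosed k] (p : ℕ) [Fact p.Prime] [CharP k p]
    {θ : ℕ} (A : Matrix (Fin θ) (Fin θ) k)
    (hdiag : ∀ i, A i i = 0 ∨ A i i = 2)
    (hsymm : ∀ i j, i ≠ j → (A i j = 0 ↔ A j i = 0))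
    {𝔥 : Type*} [AddCommGroup 𝔥] [Module k 𝔥] (R : Contragredient.Realization A 𝔥)
    (hfin : FiniteDimensional k (Contragredient.G R)) (i : Fin θ) :
    Contragredient.IsAlphaPLieAlgebra p (Contragredient.adE R i) ∧
    ∀ β : Fin θ → ℤ, Contragredient.IsStringGenerator p R i β →
      Contragredient.stringModule p R i β ≤
        Submodule.map (Contragredient.derived R).toSubmodule.subtype
          (Contragredient.alphaPLieSpan (Contragredient.adE R i)
            {x : Contragredient.derived R |
              ∃ j : Fin θ, j ≠ i ∧
                (x : Contragredient.G R) ∈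
                  Contragredient.stringModule p R i (Contragredient.simpleRoot j)}).toSubmodule := by
  refine ⟨Contragredient.isAlphaPLieAlgebra_adE p hdiag R hfin i, fun β _ => ?_⟩
  set s := {x : Contragredient.derived R | ∃ j : Fin θ, j ≠ i ∧ (x : Contragredient.G R) ∈
    Contragredient.stringModule p R i (Contragredient.simpleRoot j)}
  obtain ⟨hstable, hs⟩ :=
    Contragredient.isAlphaPLieSubalgebra_alphaPLieSpan (Contragredient.adE R i) s
  -- `K` is the image in `𝔤` of the generated subalgebra of `𝔤'`.
  refine Contragredient.stringModule_le p R (fun j hj => ?_) ?_ ?_ β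
  · exact ⟨⟨_, Contragredient.gen_e_mem_derived R j⟩,
      hs ⟨j, hj, Contragredient.gen_e_mem_stringModule p hdiag R hj⟩, rfl⟩
  · rintro _ ⟨x, hx, rfl⟩
    exact ⟨_, hstable x hx, rfl⟩
  · rintro _ ⟨x, hx, rfl⟩ _ ⟨y, hy, rfl⟩
    exact ⟨_, (Contragredient.alphaPLieSpan (Contragredient.adE R i) s).lie_mem hx hy, rfl⟩
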